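/- \textbf{Setting.} Let $S$ be a finite set of students, $C=\{c_1,\dots,c_m\}$ a finite set of colleges, and $X\subseteq S\times C$ a set of contracts. For $Y\subseteq X$ put $Y_s=\{(s,c)\in Y\}$, $Y_c=\{(s,c)\in Y\}$ and $\nu(Y)=(|Y_{c_1}|,\dots,|Y_{c_m}|)$. Each student $s$ has a strict (total) preference $\succ_s$ over $X_s\cup\{(s,\emptyset)\}$, and each college $c$ a strict preference $\succ_c$ over $X_c\cup\{(\emptyset,c)\}$ for which every contract of $X_c$ is acceptable, i.e. preferred to $(\emptyset,c)$; similarly, $(s,c)$ is acceptable for $s$ if $(s,c)\succ_s(s,\emptyset)$. Contracts have pairwise distinct positive weights $w(x)$ with $w((s,c))>w((s',c))$ whenever $(s,c)\succ_c(s',c)$, and $w(Y)=\sum_{x\in Y}w(x)$. The distributional constraints are a function $f:\mathbb Z_+^m\to\{-\infty,0\}$. A function $g:\mathbb Z_+^m\to\{-\infty,0\}$ induces the set $F=\{\nu: g(\nu)=0\}$; $g$ is hereditary if $0\in F$ and $\nu'\in F$ whenever $\nu'<\nu\in F$. A set $F\subseteq\mathbb Z_+^m$ is M$^\natural$-convex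 if for all $\nu,\nu'\in F$ and all $i$ with $\nu_i>\nu'_i$ there is $j\in\{0\}\cup\{k:\nu_k<\nu'_k\}$ with $\nu-e_i+e_j\in F$ and $\nu'+e_i-e_j\in F$, where $e_i$ is the $i$-th unit vector and $e_0=0$. \textbf{GDA.} Given a set $X'\subseteq X$ of contracts, constraints $g$ and reported preferences, let $Ch_S(Y)$ consist, for each student $s$ separately, of the most preferred contract in $Y_s$ that is acceptable for $s$ (if any), and let $Ch_C(Y)$ be the subset $Y'\subseteq Y$ maximizing $g(\nu(Y'))+w(Y')$. Start with $Re=\emptyset$ and repeat: let $Y=Ch_S(X'\setminus Re)$ and $Z=Ch_C(Y)$; if $Z=Y$, stop and return $Y$; otherwise add $Y\setminus Z$ to $Re$. \textbf{MS-GDA.} Fix a master-list $L$, i.e. an ordering of all students. Start with $Y=\emptyset$ and $f_1=f$. At Stage $k$, if no student remains in $L$, return $Y$. Otherwise choose a positive integer $d$ such that $$f_k^d(\nu)=\begin{cases}f_k(\nu)&\text{if }\sum_i\nu_i\le d,\\-\infty&\text{otherwise}\end{cases}$$ induces an M$^\natural$-convex set; remove the top $d$ remaining students (all of them, if fewer than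 $d$ remain) from $L$; let $Y^k$ be the result of GDA for the contracts of these students under the constraints $f_k^d$; replace $Y$ by $Y\cup Y^k$; set $f_{k+1}(\nu)=f(\nu+\nu(Y))$; and go to Stage $k+1$. The number $d$ is chosen by a fixed rule that may depend on everything that does not involve the reports of the students who remain in $L$ at the beginning of Stage $k$ (in particular on $k$, on the remaining list, on $Y$ and $f_k$, and on the reports of the students processed in earlier stages), and whose choice makes $f_k^d$ M$^\natural$-convex at every stage that is reached under some profile of reports. \textbf{Theorem.} If $f$ is hereditary, then MS-GDA is strategyproof, for every master-list and every such rule for choosing $d$. That is, for every profile of preferences, every student $s$ with true preference $\succ_s$, and every strict preference $\succ'_s$ over $X_s\cup\{(s,\emptyset)\}$: if $Y$ is the matching obtained when $s$ reports $\succ_s$, and $Y'$ the matching obtained when $s$ reports $\succ'_s$ while the reports of all other students are unchanged, then $s$ weakly prefers her outcome in $Y$ to her outcome in $Y'$, i.e. the two outcomes are equal or the former is ranked above the latter by $\succ_s$. Here the outcome of $s$ in a matching $Y$ is the contract in $Y_s$, or $(s,\emptyset)$ if $Y_s=\emptyset$. -/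

import Mathlib

/-- `ν(Y)`: the vector counting, for every college `c`, the contracts of `Y` that involve `c`. -/
def countVec {S C : Type*} [DecidableEq C] (Y : Finset (S × C)) : C → ℕ :=
  fun c => (Y.filter (fun x => x.2 = c)).card

/-- The induced vectors `F = {ν | f ν = 0}` of a `{-∞, 0}`-valued function `f`. -/
def inducedVectors {C : Type*} (f : (C → ℕ) → EReal) : Set (C → ℕ) :=
  {ν | f ν = 0}

/-- `f` is hereditary: `0 ∈ F`, and every vector below a member of `F` is a member of `F`. -/
def IsHereditary {C : Type*} (f : (C → ℕ) → EReal) : Prop :=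
  0 ∈ inducedVectors f ∧
    ∀ ν ν' : C → ℕ, ν' < ν → ν ∈ inducedVectors f → ν' ∈ inducedVectors f

/-- The unit vector of a college; the extra index `none` stands for the zero vector. -/
def unitVec {C : Type*} [DecidableEq C] : Option C → (C → ℕ)
  | none => 0
  | some c => Pi.single c 1

/-- M♮-convex sets of vectors of natural numbers. The subtractions never truncate: the `i`-th entry
of `ν` and (for `j = some k`) the `k`-th entry of `ν'` are positive. -/
def IsMNaturalConvexSet {C : Type*} [DecidableEq C] (F : Set (C → ℕ)) : Prop :=
  ∀ ν ∈ F, ∀ ν' ∈ F, ∀ i : C, ν' i < ν i →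
    ∃ j : Option C, (∀ k : C, j = some k → ν k < ν' k) ∧
      ν - unitVec (some i) + unitVec j ∈ F ∧ ν' + unitVec (some i) - unitVec j ∈ F

/-- `f^d`: the constraint `f` restricted to vectors of size at most `d`. -/
noncomputable def truncate {C : Type*} [Fintype C] (f : (C → ℕ) → EReal) (d : ℕ) :
    (C → ℕ) → EReal :=
  fun ν => if ∑ c, ν c ≤ d then f ν else ⊥

/-- The constraint that remains once the contracts of `Y` are fixed: `ν ↦ f (ν + ν(Y))`. -/
def residualConstraint {S C : Type*} [DecidableEq C] (f : (C → ℕ) → EReal) (Y : Finset (S × C)) :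
    (C → ℕ) → EReal :=
  fun ν => f (ν + countVec Y)

/-- `r` (where `r a b` means that `a` is preferred to `b`) is a strict total order on the set `A`.
Nothing is required of `r` outside `A`. -/
def IsStrictPref {α : Type*} (A : Set α) (r : α → α → Prop) : Prop :=
  (∀ a ∈ A, ¬ r a a) ∧
  (∀ a ∈ A, ∀ b ∈ A, ∀ c ∈ A, r a b → r b c → r a c) ∧
  (∀ a ∈ A, ∀ b ∈ A, a ≠ b → r a b ∨ r b a)

/-- The possible outcomes `X_s ∪ {(s, ∅)}` of student `s`: `some c` stands for the contract `(s, c)`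
and `none` for being unmatched. -/
def studentOutcomes {S C : Type*} (X : Finset (S × C)) (s : S) : Set (Option C) :=
  {o | ∀ c : C, o = some c → (s, c) ∈ X}

/-- The possible outcomes `X_c ∪ {(∅, c)}` of a single place of college `c`. -/
def collegeOutcomes {S C : Type*} (X : Finset (S × C)) (c : C) : Set (Option S) :=
  {o | ∀ s : S, o = some s → (s, c) ∈ X}

/-- A matching market under distributional constraints, apart from the students' preferences (which
are the reports that a mechanism collects), with the contract weights that define the colleges'
choice function. -/
structure MatchingMarket (S C : Type*) where
  /-- The contracts. -/
  X : Finset (S × C)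
  /-- The colleges' preferences. -/
  collegePref : C → Option S → Option S → Prop
  collegePref_strict : ∀ c, IsStrictPref (collegeOutcomes X c) (collegePref c)
  /-- Every contract is acceptable for its college. -/
  collegePref_acceptable : ∀ s c, (s, c) ∈ X → collegePref c (some s) none
  /-- The distributional constraints. -/
  f : (C → ℕ) → EReal
  f_values : ∀ ν, f ν = ⊥ ∨ f ν = 0
  /-- The contract weights: positive, pairwise distinct, and respecting colleges' preferences. -/
  w : S × C → ℝ
  w_pos : ∀ x ∈ X, 0 < w x
  w_injOn : Set.InjOn w (X : Set (S × C))
  w_respects : ∀ c s s', (s, c) ∈ X → (s', c) ∈ X →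
    collegePref c (some s) (some s') → w (s', c) < w (s, c)

/-- A profile of (reported) preferences, one for each student. -/
abbrev PrefProfile (S C : Type*) := S → Option C → Option C → Prop

/-- Every student's preference is a strict total order on her possible outcomes. -/
def IsPrefProfile {S C : Type*} (X : Finset (S × C)) (P : PrefProfile S C) : Prop :=
  ∀ s, IsStrictPref (studentOutcomes X s) (P s)

/-- `Y_s`: the contracts of `Y` that involve student `s`. -/
def contractsOf {S C : Type*} [DecidableEq S] (Y : Finset (S × C)) (s : S) : Finset (S × C) :=
  Y.filter (fun x => x.1 = s)

open Classical in
/-- `Ch_s`: the most preferred contract among those in `Ys` (a set of contracts of one student with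
preference `r`) if it is acceptable, and nothing otherwise. -/
noncomputable def studentChoice {S C : Type*} (r : Option C → Option C → Prop)
    (Ys : Finset (S × C)) : Finset (S × C) :=
  Ys.filter (fun x => r (some x.2) none ∧ ∀ y ∈ Ys, y ≠ x → r (some x.2) (some y.2))

/-- `Ch_S`: the union of all students' choices. -/
noncomputable def studentsChoice {S C : Type*} [Fintype S] [DecidableEq S] [DecidableEq C]
    (P : PrefProfile S C) (Y : Finset (S × C)) : Finset (S × C) :=
  Finset.univ.biUnion (fun s => studentChoice (P s) (contractsOf Y s))

/-- The objective `f(ν(Z)) + w(Z)` of the colleges' choice function. -/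
noncomputable def collegesObjective {S C : Type*} [DecidableEq C] (f : (C → ℕ) → EReal)
    (w : S × C → ℝ) (Z : Finset (S × C)) : EReal :=
  f (countVec Z) + ((∑ x ∈ Z, w x : ℝ) : EReal)

theorem exists_collegesChoice {S C : Type*} [DecidableEq C] (f : (C → ℕ) → EReal)
    (w : S × C → ℝ) (Y : Finset (S × C)) :
    ∃ Z, Z ⊆ Y ∧ ∀ Z', Z' ⊆ Y → collegesObjective f w Z' ≤ collegesObjective f w Z := by
  obtain ⟨Z, hZ, hmax⟩ := Finset.exists_max_image Y.powerset (collegesObjective f w)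
    ⟨∅, Finset.empty_mem_powerset Y⟩
  exact ⟨Z, Finset.mem_powerset.1 hZ, fun Z' hZ' => hmax Z' (Finset.mem_powerset.2 hZ')⟩

/-- `Ch_C(Y)`: a subset of `Y` that maximizes `f(ν(·)) + w(·)`. -/
noncomputable def collegesChoice {S C : Type*} [DecidableEq C] (f : (C → ℕ) → EReal)
    (w : S × C → ℝ) (Y : Finset (S × C)) : Finset (S × C) :=
  (exists_collegesChoice f w Y).choose

theorem studentsChoice_subset {S C : Type*} [Fintype S] [DecidableEq S] [DecidableEq C]
    (P : PrefProfile S C) (Y : Finset (S × C)) : studentsChoice P Y ⊆ Y := by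
  intro x hx
  obtain ⟨s, _, hs⟩ := Finset.mem_biUnion.1 hx
  have h : studentChoice (P s) (contractsOf Y s) ⊆ contractsOf Y s := by
    unfold studentChoice
    intro y hy
    simp only [Finset.mem_filter] at hy
    exact hy.1
  exact (Finset.mem_filter.1 (h hs)).1

/-- The loop of the Generalized Deferred Acceptance mechanism, where `Re` is the set of contracts
rejected so far: `Y = Ch_S(X \ Re)` is offered and `Z = Ch_C(Y)` is tentatively accepted; if nothing
is rejected, `Y` is final, and otherwise `Y \ Z` is added to `Re`. -/
noncomputable def gdaLoop {S C : Type*} [Fintype S] [DecidableEq S] [DecidableEq C]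
    (X : Finset (S × C)) (P : PrefProfile S C) (f : (C → ℕ) → EReal) (w : S × C → ℝ)
    (Re : Finset (S × C)) : Finset (S × C) :=
  if studentsChoice P (X \ Re) \ collegesChoice f w (studentsChoice P (X \ Re)) = ∅ then
    studentsChoice P (X \ Re)
  else
    gdaLoop X P f w
      (Re ∪ (studentsChoice P (X \ Re) \ collegesChoice f w (studentsChoice P (X \ Re))))
termination_by (X \ Re).card
decreasing_by
  rename_i h
  obtain ⟨x, hx⟩ := Finset.nonempty_iff_ne_empty.2 h
  have hxX := studentsChoice_subset P (X \ Re) (Finset.mem_sdiff.1 hx).1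
  apply Finset.card_lt_card
  refine Finset.ssubset_iff_subset_ne.2
    ⟨Finset.sdiff_subset_sdiff subset_rfl Finset.subset_union_left, fun heq => ?_⟩
  rw [← heq] at hxX
  exact (Finset.mem_sdiff.1 hxX).2 (Finset.mem_union_right _ hx)

/-- The Generalized Deferred Acceptance mechanism for the contracts `X`, the reported preferences
`P`, the constraints `f` and the weights `w`. -/
noncomputable def gda {S C : Type*} [Fintype S] [DecidableEq S] [DecidableEq C]
    (X : Finset (S × C)) (P : PrefProfile S C) (f : (C → ℕ) → EReal) (w : S × C → ℝ) :
    Finset (S × C) :=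
  gdaLoop X P f w ∅

/-- A state of the multi-stage mechanism at the start of a stage: the students that remain in the
master-list, and the contracts `Y` fixed in the previous stages. -/
structure StageState (S C : Type*) where
  rest : List S
  Y : Finset (S × C)

/-- A rule for the stage sizes `d`. A stage size may depend on everything that is known when the
stage starts: the number of the stage, the state, and the reports of the students that have been
processed in previous stages (the report of a student who remains is replaced by `none`). -/
abbrev StageSizeRule (S C : Type*) :=
  ℕ → StageState S C → (S → Option (Option C → Option C → Prop)) → ℕ+

/-- The reports of the students that are not in `rest` any more. -/
def pastReports {S C : Type*} [DecidableEq S] (P : PrefProfile S C) (rest : List S) :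
    S → Option (Option C → Option C → Prop) :=
  fun s => if s ∈ rest then none else some (P s)

namespace MatchingMarket

variable {S C : Type*} [Fintype S] [DecidableEq S] [Fintype C] [DecidableEq C]

/-- One stage with stage size `d`: the top `d` remaining students are removed from the master-list
and assigned by GDA under the truncation to size `d` of the residual constraint. -/
noncomputable def stageStep (M : MatchingMarket S C) (P : PrefProfile S C) (d : ℕ)
    (σ : StageState S C) : StageState S C where
  rest := σ.rest.drop d
  Y := σ.Y ∪ gda (M.X.filter (fun x => x.1 ∈ σ.rest.take d)) P
    (truncate (residualConstraint M.f σ.Y) d) M.w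

/-- The state in which stage `k` starts (stages are numbered from `0`) when the master-list is `L`,
the stage sizes are chosen by `δ` and `P` is reported. Once no student remains, nothing changes. -/
noncomputable def stageState (M : MatchingMarket S C) (L : List S) (δ : StageSizeRule S C)
    (P : PrefProfile S C) : ℕ → StageState S C
  | 0 => ⟨L, ∅⟩
  | k + 1 =>
    if (M.stageState L δ P k).rest = [] then M.stageState L δ P k
    else M.stageStep P
      (δ k (M.stageState L δ P k) (pastReports P (M.stageState L δ P k).rest))
      (M.stageState L δ P k)

/-- The matching produced by the Multi-Stage Generalized Deferred Acceptance mechanism. Every stage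
removes at least one student, so no student remains after `L.length` stages. -/
noncomputable def msgda (M : MatchingMarket S C) (L : List S) (δ : StageSizeRule S C)
    (P : PrefProfile S C) : Finset (S × C) :=
  (M.stageState L δ P L.length).Y

/-- The mechanism has indeed terminated after `L.length` stages. -/
theorem rest_stageState_length (M : MatchingMarket S C) (L : List S) (δ : StageSizeRule S C)
    (P : PrefProfile S C) : (M.stageState L δ P L.length).rest = [] := by
  have key : ∀ k, (M.stageState L δ P k).rest.length ≤ L.length - k := by
    intro k
    induction k with
    | zero => simp [stageState]
    | succ k ih =>
      rw [stageState]
      split_ifs with h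
      · simp [h]
      · have hd := (δ k (M.stageState L δ P k) (pastReports P (M.stageState L δ P k).rest)).pos
        simp only [stageStep, List.length_drop]
        omega
  have h := key L.length
  rw [Nat.sub_self, Nat.le_zero] at h
  exact List.length_eq_zero_iff.1 h

/-- The rule `δ` is admissible: in every stage of every run of the mechanism, the chosen `d` makes
the truncated constraint of the stage M♮-convex. -/
def IsAdmissible (M : MatchingMarket S C) (L : List S) (δ : StageSizeRule S C) : Prop :=
  ∀ P : PrefProfile S C, IsPrefProfile M.X P → ∀ k : ℕ, (M.stageState L δ P k).rest ≠ [] →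
    IsMNaturalConvexSet (inducedVectors
      (truncate (residualConstraint M.f (M.stageState L δ P k).Y)
        (δ k (M.stageState L δ P k) (pastReports P (M.stageState L δ P k).rest))))

end MatchingMarket

/-- `Y_s ≻_s Y'_s` for student `s` with preference `r`, where `Y_s = ∅` is the outcome `(s, ∅)`. -/
def StudentPrefers {S C : Type*} [DecidableEq S] (r : Option C → Option C → Prop) (s : S)
    (Y Y' : Finset (S × C)) : Prop :=
  (∃ c c', contractsOf Y s = {(s, c)} ∧ contractsOf Y' s = {(s, c')} ∧ r (some c) (some c')) ∨
  (∃ c, contractsOf Y s = {(s, c)} ∧ contractsOf Y' s = ∅ ∧ r (some c) none) ∨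
  (∃ c', contractsOf Y s = ∅ ∧ contractsOf Y' s = {(s, c')} ∧ r none (some c'))

/-- `Y_s ⪰_s Y'_s`. -/
def StudentWeaklyPrefers {S C : Type*} [DecidableEq S] (r : Option C → Option C → Prop) (s : S)
    (Y Y' : Finset (S × C)) : Prop :=
  StudentPrefers r s Y Y' ∨ contractsOf Y s = contractsOf Y' s

/-- A mechanism `φ` for the contracts `X` is strategyproof: whatever the other students report,
a student with true preference `P s` weakly prefers the result of reporting `P s` to the result of
reporting any other preference `r`. -/
def IsStrategyproof {S C : Type*} [DecidableEq S] (X : Finset (S × C))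
    (φ : PrefProfile S C → Finset (S × C)) : Prop :=
  ∀ P : PrefProfile S C, IsPrefProfile X P → ∀ s : S, ∀ r : Option C → Option C → Prop,
    IsStrictPref (studentOutcomes X s) r →
      StudentWeaklyPrefers (P s) s (φ P) (φ (Function.update P s r))

/-! A report of `s` cannot influence anything before she is processed, and her outcome never changes
after that stage. The state and the size `d` of her stage are therefore the same under both reports,
so it suffices that GDA is strategyproof within one stage.

The constraint of a stage is hereditary, because the contracts already fixed are feasible, and it is
M♮-convex by assumption. M♮-convexity yields augmentation, so the feasible sets of contracts are the
independent sets of a matroid (`exists_isConstraintMatroid`), and the colleges choose an independent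
set of maximum weight. A rejected contract is then spanned by heavier accepted ones. Stability is
phrased through this spanning relation, which makes GDA stable (`isStableMatching_gda`) and
student-optimal (`weaklyDominates_gda`). Comparing ranks gives a rural hospitals theorem
(`IsStableMatching.image_fst_eq`).

Suppose a misreport gives `s` an acceptable `(s, c)` that beats her truthful outcome. Delete her
contracts worse than `(s, c)` and run GDA truthfully, with result `D`. If `D` matched `s`, it would
be stable in the full market, contradicting optimality of the truthful outcome. So `D` leaves `s`
unmatched and remains stable when only `(s, c)` is left to her. In that market the matching from the
misreport is also stable and matches `s`, against the rural hospitals theorem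
(`gda_update_not_better`). -/

/-! ### Augmentation in M♮-convex sets -/

section MNaturalConvex

variable {C : Type*} [Fintype C] [DecidableEq C]

/-- Augmentation property of M♮-convex sets: a member of smaller size can be increased by one in a
coordinate in which it is exceeded by a given member of larger size. -/
theorem IsMNaturalConvexSet.exists_add_unitVec_mem {F : Set (C → ℕ)}
    (hF : IsMNaturalConvexSet F) {μ : C → ℕ} (hμ : μ ∈ F) :
    ∀ (n : ℕ) (ν : C → ℕ), ν ∈ F → ∑ c, (ν c - μ c) = n → ∑ c, μ c < ∑ c, ν c →
      ∃ i, μ i < ν i ∧ μ + unitVec (some i) ∈ F := by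
  intro n
  induction n with
  | zero =>
    intro ν _ h0 hlt
    have hle : ∑ c, ν c ≤ ∑ c, μ c := Finset.sum_le_sum fun c hc => by
      have := Finset.sum_eq_zero_iff.1 h0 c hc
      omega
    omega
  | succ n ih =>
    intro ν hν hn hlt
    obtain ⟨i, -, hi⟩ := Finset.exists_lt_of_sum_lt hlt
    obtain ⟨j, hj, hj1, hj2⟩ := hF ν hν μ hμ i hi
    cases j with
    | none => exact ⟨i, hi, by simpa [unitVec] using hj2⟩
    | some k =>
      -- Here `ν - e_i + e_k` lies in `F`, has the size of `ν` and is one step closer to `μ`: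
      -- coordinate `k` stays at most `μ k`, so its truncated difference remains zero. The induction
      -- applies to it.
      have hk := hj k rfl
      have hki : k ≠ i := fun h => by subst h; omega
      have hval : ∀ c, (ν - unitVec (some i) + unitVec (some k)) c =
          if c = i then ν i - 1 else if c = k then ν k + 1 else ν c := by
        intro c
        by_cases h1 : c = i
        · subst h1
          simp [unitVec, hki.symm]
        · by_cases h2 : c = k
          · subst h2
            simp [unitVec, hki]
          · simp [unitVec, h1, h2]
      have hsum : ∑ c, (ν - unitVec (some i) + unitVec (some k)) c = ∑ c, ν c := by
        have h : ∑ c, ((ν - unitVec (some i) + unitVec (some k)) c + unitVec (some i) c) =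
            ∑ c, (ν c + unitVec (some k) c) := Finset.sum_congr rfl fun c _ => by
          rw [hval]
          by_cases h1 : c = i
          · subst h1
            simp [unitVec, hki.symm]
            omega
          · by_cases h2 : c = k
            · subst h2
              simp [unitVec, hki]
            · simp [unitVec, h1, h2]
        simp only [Finset.sum_add_distrib, unitVec, Finset.sum_pi_single', Finset.mem_univ,
          if_true] at h
        simpa [unitVec] using h
      have hdist : ∑ c, ((ν - unitVec (some i) + unitVec (some k)) c - μ c) = n := by
        have h : ∑ c, ((ν - unitVec (some i) + unitVec (some k)) c - μ c) + 1 =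
            ∑ c, (ν c - μ c) := by
          rw [← Finset.add_sum_erase _ _ (Finset.mem_univ i),
            ← Finset.add_sum_erase _ (fun c => ν c - μ c) (Finset.mem_univ i)]
          have : ∑ c ∈ Finset.univ.erase i, ((ν - unitVec (some i) + unitVec (some k)) c - μ c) =
              ∑ c ∈ Finset.univ.erase i, (ν c - μ c) := Finset.sum_congr rfl fun c hc => by
            rw [hval, if_neg (Finset.ne_of_mem_erase hc)]
            split_ifs with h2
            · subst h2
              omega
            · rfl
          rw [this, hval, if_pos rfl]
          omega
        omega
      obtain ⟨i', hi', hmem⟩ := ih _ hj1 hdist (by rw [hsum]; exact hlt)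
      refine ⟨i', ?_, hmem⟩
      rw [hval] at hi'
      split_ifs at hi' with h1 h2
      · subst h1
        omega
      · subst h2
        omega
      · exact hi'

end MNaturalConvex

/-! ### Count vectors -/

section CountVec

variable {S C : Type*} [DecidableEq C]

theorem countVec_mono {Y Y' : Finset (S × C)} (h : Y ⊆ Y') : countVec Y ≤ countVec Y' :=
  fun _ => Finset.card_le_card (Finset.filter_subset_filter _ h)

@[simp]
theorem countVec_empty : countVec (∅ : Finset (S × C)) = 0 := by
  ext c
  simp [countVec]

theorem sum_countVec [Fintype C] (Y : Finset (S × C)) : ∑ c, countVec Y c = Y.card :=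
  (Finset.card_eq_sum_card_fiberwise (f := Prod.snd) (t := Finset.univ) (by simp)).symm

variable [DecidableEq S]

theorem countVec_insert {Y : Finset (S × C)} {x : S × C} (hx : x ∉ Y) :
    countVec (insert x Y) = countVec Y + unitVec (some x.2) := by
  ext c
  rw [Pi.add_apply, countVec, countVec, Finset.filter_insert]
  split_ifs with h
  · subst h
    simp [unitVec, hx]
  · simp [unitVec, Ne.symm h]

theorem countVec_union {Y Y' : Finset (S × C)} (h : Disjoint Y Y') :
    countVec (Y ∪ Y') = countVec Y + countVec Y' := by
  ext c
  rw [Pi.add_apply, countVec, countVec, countVec, Finset.filter_union,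
    Finset.card_union_of_disjoint (Finset.disjoint_filter_filter h)]

end CountVec

theorem IsHereditary.of_le {C : Type*} {f : (C → ℕ) → EReal} (hf : IsHereditary f) {ν ν' : C → ℕ}
    (h : ν' ≤ ν) (hν : f ν = 0) : f ν' = 0 := by
  rcases h.eq_or_lt with rfl | h
  · exact hν
  · exact hf.2 ν ν' h hν

/-! ### The colleges' choice as a weight maximizer -/

section CollegesChoice

variable {S C : Type*}

/-- The members of `Z` that have a larger weight than `x`. -/
def heavier (w : S × C → ℝ) (Z : Finset (S × C)) (x : S × C) : Set (S × C) :=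
  {z | z ∈ Z ∧ w x < w z}

theorem heavier_subset (w : S × C → ℝ) (Z : Finset (S × C)) (x : S × C) : heavier w Z x ⊆ Z :=
  fun _ h => h.1

theorem heavier_trans {w : S × C → ℝ} {Z : Finset (S × C)} {x y : S × C} (h : w x ≤ w y) :
    heavier w Z y ⊆ heavier w Z x :=
  fun _ hz => ⟨hz.1, h.trans_lt hz.2⟩

theorem heavier_mono {w : S × C → ℝ} {Z Z' : Finset (S × C)} (h : Z ⊆ Z') (x : S × C) :
    heavier w Z x ⊆ heavier w Z' x :=
  fun _ hz => ⟨h hz.1, hz.2⟩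

variable [DecidableEq C]

theorem collegesChoice_subset (g : (C → ℕ) → EReal) (w : S × C → ℝ) (Y : Finset (S × C)) :
    collegesChoice g w Y ⊆ Y :=
  (exists_collegesChoice g w Y).choose_spec.1

theorem le_collegesObjective_collegesChoice (g : (C → ℕ) → EReal) (w : S × C → ℝ)
    {Y Z : Finset (S × C)} (hZ : Z ⊆ Y) :
    collegesObjective g w Z ≤ collegesObjective g w (collegesChoice g w Y) :=
  (exists_collegesChoice g w Y).choose_spec.2 Z hZ

theorem collegesObjective_of_eq_zero {g : (C → ℕ) → EReal} (w : S × C → ℝ) {Z : Finset (S × C)}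
    (h : g (countVec Z) = 0) : collegesObjective g w Z = ((∑ x ∈ Z, w x : ℝ) : EReal) := by
  rw [collegesObjective, h, zero_add]

end CollegesChoice

/-! ### The matroid of feasible sets of contracts -/

section ConstraintMatroid

variable {S C : Type*} [DecidableEq C]

/-- `N` is the matroid, on the set of all possible contracts, of the sets of contracts that are
feasible under the constraint `g`. -/
structure IsConstraintMatroid (N : Matroid (S × C)) (g : (C → ℕ) → EReal) : Prop where
  ground : N.E = Set.univ
  indep_iff : ∀ I : Finset (S × C), N.Indep (I : Set (S × C)) ↔ g (countVec I) = 0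
  values : ∀ ν, g ν = ⊥ ∨ g ν = 0

/-- Augmentation of count vectors finds a college at which `J` has more contracts than `I`. Any
contract of `J \ I` at that college can be added to `I`, since the constraint sees only counts. -/
theorem exists_isConstraintMatroid [DecidableEq S] [Fintype C] {g : (C → ℕ) → EReal}
    (hg : IsHereditary g) (hconv : IsMNaturalConvexSet (inducedVectors g)) (hval : ∀ ν, g ν = ⊥ ∨ g ν = 0) :
    ∃ N : Matroid (S × C), IsConstraintMatroid N g := by
  let N : IndepMatroid (S × C) := IndepMatroid.ofFinset Set.univ (fun I => g (countVec I) = 0)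
    (by rw [countVec_empty]; exact hg.1) (fun I J hJ hIJ => hg.of_le (countVec_mono hIJ) hJ)
    (by
      intro I J hI hJ hlt
      rw [← sum_countVec, ← sum_countVec J] at hlt
      obtain ⟨i, hi, hmem⟩ := hconv.exists_add_unitVec_mem hI _ _ hJ rfl hlt
      obtain ⟨e, heJ, heI⟩ := Finset.exists_mem_notMem_of_card_lt_card hi
      simp only [Finset.mem_filter] at heJ heI
      have heI' : e ∉ I := fun h => heI ⟨h, heJ.2⟩
      refine ⟨e, heJ.1, heI', ?_⟩
      rw [countVec_insert heI', heJ.2]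
      exact hmem)
    (fun _ _ => Set.subset_univ _)
  refine ⟨N.matroid, rfl, fun I => ?_, hval⟩
  simp only [N, IndepMatroid.matroid_Indep, IndepMatroid.ofFinset_indep]

namespace IsConstraintMatroid

variable {N : Matroid (S × C)} {g : (C → ℕ) → EReal}

/-- An infeasible set has objective `⊥` and would lose against the empty set. -/
theorem collegesChoice_feasible (hN : IsConstraintMatroid N g) (w : S × C → ℝ)
    (Y : Finset (S × C)) : g (countVec (collegesChoice g w Y)) = 0 := by
  refine (hN.values _).resolve_left fun h => ?_
  have h0 : g (countVec (∅ : Finset (S × C))) = 0 := by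
    rw [← hN.indep_iff]
    simp
  have hle := le_collegesObjective_collegesChoice g w (Finset.empty_subset Y)
  rw [collegesObjective_of_eq_zero w h0, collegesObjective, h, EReal.bot_add] at hle
  simp at hle

theorem sum_le_of_indep (hN : IsConstraintMatroid N g) (w : S × C → ℝ) {Y I : Finset (S × C)}
    (hI : N.Indep (I : Set (S × C))) (hIY : I ⊆ Y) :
    ∑ x ∈ I, w x ≤ ∑ x ∈ collegesChoice g w Y, w x := by
  have hle := le_collegesObjective_collegesChoice g w hIY
  rw [collegesObjective_of_eq_zero w ((hN.indep_iff I).1 hI),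
    collegesObjective_of_eq_zero w (hN.collegesChoice_feasible w Y)] at hle
  exact_mod_cast hle

/-- A rejected contract is spanned by the accepted contracts of larger weight. -/
theorem mem_closure_heavier_of_rejected [DecidableEq S] (hN : IsConstraintMatroid N g)
    {w : S × C → ℝ} {Y : Finset (S × C)} (hpos : ∀ x ∈ Y, 0 < w x) (hinj : Set.InjOn w (Y : Set (S × C)))
    {x : S × C} (hx : x ∈ Y) (hxZ : x ∉ collegesChoice g w Y) :
    x ∈ N.closure (heavier w (collegesChoice g w Y) x) := by
  set Z := collegesChoice g w Y with hZdef
  have hZY : Z ⊆ Y := collegesChoice_subset g w Y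
  have hZ : N.Indep (Z : Set (S × C)) := (hN.indep_iff Z).2 (hN.collegesChoice_feasible w Y)
  have hxE : x ∈ N.E := hN.ground ▸ Set.mem_univ x
  have hxZ' : x ∉ (Z : Set (S × C)) := by simpa using hxZ
  -- Otherwise `x`, having positive weight, could be added to `Z` at a profit.
  have hcl : x ∈ N.closure (Z : Set (S × C)) := by
    by_contra hcl
    have hins : N.Indep ((insert x Z : Finset (S × C)) : Set (S × C)) := by
      rw [Finset.coe_insert]
      exact ((hZ.notMem_closure_iff hxE).1 hcl).1
    have hle := hN.sum_le_of_indep w hins (Finset.insert_subset hx hZY)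
    rw [Finset.sum_insert hxZ] at hle
    linarith [hpos x hx]
  -- Replacing an element `z` of the fundamental circuit by `x` keeps independence, so maximality
  -- gives `w x ≤ w z`; distinct weights make this strict.
  have hsub : N.fundCircuit x Z ⊆ insert x (heavier w Z x) := by
    intro z hz
    rcases eq_or_ne z x with rfl | hzx
    · exact Set.mem_insert _ _
    have hzZ : z ∈ Z := by
      have := N.fundCircuit_subset_insert x Z hz
      simpa [hzx] using this
    refine Set.mem_insert_of_mem _ ⟨hzZ, ?_⟩
    have hex : N.Indep ((insert x (Z.erase z) : Finset (S × C)) : Set (S × C)) := by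
      have := (hZ.mem_fundCircuit_iff hcl hxZ').1 hz
      rw [Finset.coe_insert, Finset.coe_erase]
      rwa [Set.insert_sdiff_singleton_comm hzx.symm]
    have hle := hN.sum_le_of_indep w hex
      (Finset.insert_subset hx ((Finset.erase_subset _ _).trans hZY))
    rw [Finset.sum_insert (fun h => hxZ (Finset.mem_of_mem_erase h)),
      ← Finset.add_sum_erase _ _ hzZ] at hle
    refine lt_of_le_of_ne (by linarith) fun h => hzx (hinj (hZY hzZ) hx h.symm)
  have hC := hZ.fundCircuit_isCircuit hcl hxZ'
  refine N.closure_subset_closure ?_ (hC.mem_closure_sdiff_singleton_of_mem (N.mem_fundCircuit x Z))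
  rintro z ⟨hz, hzx⟩
  exact (hsub hz).resolve_left hzx

end IsConstraintMatroid

end ConstraintMatroid

/-! ### Stable matchings and the students' choice -/

section Stability

variable {S C : Type*}

/-- Contracts of the matching `A` are weakly better, for their students, than those of `B`. -/
def WeaklyDominates (P : PrefProfile S C) (A B : Finset (S × C)) : Prop :=
  ∀ b ∈ B, ∃ a ∈ A, a.1 = b.1 ∧ (a = b ∨ P b.1 (some a.2) (some b.2))

/-- Stability of the matching `B` in the market with contracts `X`, preferences `P` and the
colleges' choice function given by the matroid `N` and the weights `w`. -/
structure IsStableMatching (N : Matroid (S × C)) (w : S × C → ℝ) (X : Finset (S × C))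
    (P : PrefProfile S C) (B : Finset (S × C)) : Prop where
  subset : B ⊆ X
  indep : N.Indep (B : Set (S × C))
  acceptable : ∀ b ∈ B, P b.1 (some b.2) none
  injOn : Set.InjOn Prod.fst (B : Set (S × C))
  -- Being spanned by heavier contracts of `B` is the matroid form of being refused by the colleges.
  -- Unlike a statement about choice functions, it composes through closures.
  not_block : ∀ x ∈ X, P x.1 (some x.2) none →
    (∀ b ∈ B, b.1 = x.1 → b = x ∨ P x.1 (some x.2) (some b.2)) →
      x ∈ B ∨ x ∈ N.closure (heavier w B x)

theorem IsStrictPref.mono {α : Type*} {A B : Set α} {r : α → α → Prop} (h : IsStrictPref B r)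
    (hAB : A ⊆ B) : IsStrictPref A r :=
  ⟨fun a ha => h.1 a (hAB ha), fun a ha b hb c hc => h.2.1 a (hAB ha) b (hAB hb) c (hAB hc),
    fun a ha b hb => h.2.2 a (hAB ha) b (hAB hb)⟩

theorem studentOutcomes_mono {X X' : Finset (S × C)} (h : X ⊆ X') (s : S) :
    studentOutcomes X s ⊆ studentOutcomes X' s :=
  fun _ ho c hc => h (ho c hc)

theorem IsPrefProfile.mono {X X' : Finset (S × C)} {P : PrefProfile S C}
    (hP : IsPrefProfile X' P) (h : X ⊆ X') : IsPrefProfile X P :=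
  fun s => (hP s).mono (studentOutcomes_mono h s)

theorem none_mem_studentOutcomes (X : Finset (S × C)) (s : S) : none ∈ studentOutcomes X s :=
  fun _ h => nomatch h

theorem some_mem_studentOutcomes {X : Finset (S × C)} {s : S} {c : C} :
    some c ∈ studentOutcomes X s ↔ (s, c) ∈ X := by
  simp [studentOutcomes]

namespace IsPrefProfile

variable {X : Finset (S × C)} {P : PrefProfile S C}

theorem irrefl (hP : IsPrefProfile X P) {s : S} {c : C} (h : (s, c) ∈ X) :
    ¬ P s (some c) (some c) :=
  (hP s).1 _ (some_mem_studentOutcomes.2 h)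

theorem trans (hP : IsPrefProfile X P) {s : S} {a b : C} {o : Option C} (ha : (s, a) ∈ X)
    (hb : (s, b) ∈ X) (ho : o ∈ studentOutcomes X s) (hab : P s (some a) (some b))
    (hbo : P s (some b) o) : P s (some a) o :=
  (hP s).2.1 _ (some_mem_studentOutcomes.2 ha) _ (some_mem_studentOutcomes.2 hb) _ ho hab hbo

end IsPrefProfile

/-- Rural hospitals: a stable matching that weakly dominates another one matches the same
students. -/
theorem IsStableMatching.image_fst_eq [DecidableEq S] {N : Matroid (S × C)} {w : S × C → ℝ}
    {X : Finset (S × C)} {P : PrefProfile S C} {A B : Finset (S × C)} (hE : N.E = Set.univ)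
    (hA : IsStableMatching N w X P A) (hB : IsStableMatching N w X P B)
    (hAB : WeaklyDominates P A B) : B.image Prod.fst = A.image Prod.fst := by
  refine Finset.eq_of_subset_of_card_le (fun s hs => ?_) ?_
  · obtain ⟨b, hb, rfl⟩ := Finset.mem_image.1 hs
    obtain ⟨a, ha, hab, -⟩ := hAB b hb
    exact Finset.mem_image.2 ⟨a, ha, hab⟩
  · rw [Finset.card_image_of_injOn hA.injOn, Finset.card_image_of_injOn hB.injOn]
    -- Each student of `A` weakly prefers her contract there to the one in `B`, so stability of `B`
    -- forces that contract into the span of `B`. Hence the rank of `A` is at most that of `B`.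
    have hcl : (A : Set (S × C)) ⊆ N.closure B := fun a ha => by
      rcases hB.not_block a (hA.subset ha) (hA.acceptable a ha) (fun b hb hba => by
        obtain ⟨a', ha', haa', h⟩ := hAB b hb
        obtain rfl := hA.injOn ha' ha (haa'.trans hba)
        rw [hba] at h
        exact h.imp_left Eq.symm) with h | h
      · exact N.mem_closure_of_mem' (Finset.mem_coe.2 h) (hE ▸ Set.mem_univ a)
      · exact N.closure_subset_closure (heavier_subset w B a) h
    have h1 : N.eRk A ≤ N.eRk B := by
      rw [← N.eRk_closure_eq B]
      exact N.eRk_mono hcl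
    rw [hA.indep.eRk_eq_encard, hB.indep.eRk_eq_encard] at h1
    simpa using h1

theorem mem_studentChoice {r : Option C → Option C → Prop} {Y : Finset (S × C)} {x : S × C} :
    x ∈ studentChoice r Y ↔
      x ∈ Y ∧ r (some x.2) none ∧ ∀ y ∈ Y, y ≠ x → r (some x.2) (some y.2) := by
  classical
  unfold studentChoice
  exact Finset.mem_filter

variable [Fintype S] [DecidableEq S] [DecidableEq C]

theorem mem_studentsChoice {P : PrefProfile S C} {Y : Finset (S × C)} {x : S × C} :
    x ∈ studentsChoice P Y ↔ x ∈ Y ∧ P x.1 (some x.2) none ∧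
      ∀ y ∈ Y, y.1 = x.1 → y ≠ x → P x.1 (some x.2) (some y.2) := by
  simp only [studentsChoice, mem_studentChoice, contractsOf, Finset.mem_biUnion, Finset.mem_univ,
    true_and, Finset.mem_filter]
  constructor
  · rintro ⟨s, ⟨hx, rfl⟩, h1, h2⟩
    exact ⟨hx, h1, fun y hy hs => h2 y ⟨hy, hs⟩⟩
  · rintro ⟨hx, h1, h2⟩
    exact ⟨x.1, ⟨hx, rfl⟩, h1, fun y hy => h2 y hy.1 hy.2⟩

theorem mem_studentsChoice_of_subset {P : PrefProfile S C} {Y Y' : Finset (S × C)} {x : S × C}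
    (h : Y' ⊆ Y) (hx : x ∈ Y') (hxY : x ∈ studentsChoice P Y) : x ∈ studentsChoice P Y' := by
  rw [mem_studentsChoice] at hxY ⊢
  exact ⟨hx, hxY.2.1, fun y hy => hxY.2.2 y (h hy)⟩

theorem IsPrefProfile.injOn_studentsChoice {X Y : Finset (S × C)} {P : PrefProfile S C}
    (hP : IsPrefProfile X P) (hYX : Y ⊆ X) :
    Set.InjOn Prod.fst (studentsChoice P Y : Set (S × C)) := by
  rintro ⟨s, a⟩ ha ⟨s', b⟩ hb (rfl : s = s')
  rw [Finset.mem_coe, mem_studentsChoice] at ha hb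
  by_contra hne
  have h1 := ha.2.2 _ hb.1 rfl (Ne.symm hne)
  have h2 := hb.2.2 _ ha.1 rfl hne
  have haX := hYX ha.1
  exact hP.irrefl haX (hP.trans haX (hYX hb.1) (some_mem_studentOutcomes.2 haX) h1 h2)

/-- A student with an acceptable contract chooses a contract that is at least as good. -/
theorem IsPrefProfile.exists_mem_studentsChoice {X Y : Finset (S × C)} {P : PrefProfile S C}
    (hP : IsPrefProfile X P) (hYX : Y ⊆ X) {b : S × C} (hb : b ∈ Y)
    (hacc : P b.1 (some b.2) none) :
    ∃ a ∈ studentsChoice P Y, a.1 = b.1 ∧ (a = b ∨ P b.1 (some a.2) (some b.2)) := by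
  -- If `b` is not the student's best contract, delete it and continue from a better one; the choice
  -- made without `b` beats `b` and so remains the choice from `Y`.
  induction hn : (Y.filter fun y => y.1 = b.1).card using Nat.strong_induction_on
    generalizing Y b with
  | _ n ih =>
    by_cases hbest : ∀ y ∈ Y, y.1 = b.1 → y ≠ b → P b.1 (some b.2) (some y.2)
    · exact ⟨b, mem_studentsChoice.2 ⟨hb, hacc, hbest⟩, rfl, Or.inl rfl⟩
    push Not at hbest
    obtain ⟨⟨s, c⟩, hy, hs, hne, hnot⟩ := hbest
    obtain ⟨t, e⟩ := b
    obtain rfl : s = t := hs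
    have hbX := hYX hb
    have hyX := hYX hy
    have hce : P s (some c) (some e) := by
      refine ((hP s).2.2 _ (some_mem_studentOutcomes.2 hyX) _ (some_mem_studentOutcomes.2 hbX)
        fun h => hne ?_).resolve_right hnot
      rw [Option.some_inj.1 h]
    have hcacc : P s (some c) none :=
      hP.trans hyX hbX (none_mem_studentOutcomes X s) hce hacc
    have hlt : ((Y.erase (s, e)).filter fun y => y.1 = s).card < n := by
      rw [← hn]
      refine Finset.card_lt_card (Finset.ssubset_iff_subset_ne.2
        ⟨Finset.filter_subset_filter _ (Finset.erase_subset _ _), fun h => ?_⟩)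
      have : (s, e) ∈ Y.filter fun y => y.1 = s := Finset.mem_filter.2 ⟨hb, rfl⟩
      rw [← h] at this
      simp at this
    obtain ⟨⟨s', a⟩, ha, has, hac⟩ := ih _ hlt ((Finset.erase_subset _ _).trans hYX)
      (Finset.mem_erase.2 ⟨hne, hy⟩) hcacc rfl
    obtain rfl : s' = s := has
    have haY := Finset.mem_of_mem_erase (studentsChoice_subset _ _ ha)
    have hae : P s' (some a) (some e) := by
      rcases hac with h | h
      · rw [(Prod.mk.inj h).2]
        exact hce
      · exact hP.trans (hYX haY) hyX (some_mem_studentOutcomes.2 hbX) h hce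
    rw [mem_studentsChoice] at ha
    refine ⟨(s', a), mem_studentsChoice.2 ⟨haY, ha.2.1, fun y hyY hys hya => ?_⟩, rfl,
      Or.inr hae⟩
    by_cases hyb : y = (s', e)
    · rw [hyb]
      exact hae
    · exact ha.2.2 y (Finset.mem_erase.2 ⟨hyb, hyY⟩) hys hya

end Stability

/-! ### Stability, optimality and incentives of deferred acceptance -/

section GDA

variable {S C : Type*} [Fintype S] [DecidableEq S] [DecidableEq C]

/-- What the deferred acceptance loop maintains about the set `Re` of rejected contracts: they are
spanned by heavier contracts that are currently offered, and they belong to no stable matching. -/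
structure IsRejectedSet (N : Matroid (S × C)) (w : S × C → ℝ) (X : Finset (S × C))
    (P : PrefProfile S C) (Re : Finset (S × C)) : Prop where
  mem_closure : ∀ x ∈ Re, x ∈ N.closure (heavier w (studentsChoice P (X \ Re)) x)
  disjoint : ∀ B, IsStableMatching N w X P B → Disjoint Re B

variable {N : Matroid (S × C)} {g : (C → ℕ) → EReal} {w : S × C → ℝ} {X : Finset (S × C)}
  {P : PrefProfile S C}

/-- Spanning survives because accepted contracts span the rejected ones and are offered again in the
next round. Disjointness survives because a stable matching containing a newly rejected contract
would be dependent. -/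
theorem IsRejectedSet.union_rejected {Re : Finset (S × C)} (hRe : IsRejectedSet N w X P Re)
    (hN : IsConstraintMatroid N g) (hpos : ∀ x ∈ X, 0 < w x)
    (hinj : Set.InjOn w (X : Set (S × C))) :
    IsRejectedSet N w X P
      (Re ∪ (studentsChoice P (X \ Re) \ collegesChoice g w (studentsChoice P (X \ Re)))) := by
  set Y := studentsChoice P (X \ Re) with hY
  set Z := collegesChoice g w Y with hZ
  have hYX' : Y ⊆ X \ Re := studentsChoice_subset P _
  have hYX : Y ⊆ X := hYX'.trans Finset.sdiff_subset
  have hZY : Z ⊆ Y := collegesChoice_subset g w Y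
  have hYZ : ∀ y ∈ Y, y ∈ Z ∨ y ∈ N.closure (heavier w Z y) := fun y hy => by
    refine or_iff_not_imp_left.2 fun h => ?_
    exact hN.mem_closure_heavier_of_rejected (fun x hx => hpos x (hYX hx))
      (hinj.mono (by exact_mod_cast hYX)) hy h
  have hspan : ∀ x, N.closure (heavier w Y x) ⊆ N.closure (heavier w Z x) := fun x => by
    refine Matroid.closure_subset_closure_of_subset_closure fun y hy => ?_
    rcases hYZ y hy.1 with h | h
    · exact N.mem_closure_of_mem' ⟨h, hy.2⟩ (hN.ground ▸ Set.mem_univ y)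
    · exact N.closure_subset_closure (heavier_trans hy.2.le) h
  have hZnext : Z ⊆ studentsChoice P (X \ (Re ∪ (Y \ Z))) := fun z hz => by
    refine mem_studentsChoice_of_subset
      (Finset.sdiff_subset_sdiff subset_rfl Finset.subset_union_left) ?_ (hZY hz)
    have := hYX' (hZY hz)
    simp only [Finset.mem_sdiff, Finset.mem_union] at this ⊢
    tauto
  refine ⟨fun x hx => ?_, fun B hB => ?_⟩
  · refine N.closure_subset_closure (heavier_mono hZnext x) ?_
    rcases Finset.mem_union.1 hx with h | h
    · exact hspan x (hRe.mem_closure x h)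
    · rw [Finset.mem_sdiff] at h
      exact (hYZ x h.1).resolve_left h.2
  · have hdis := hRe.disjoint B hB
    rw [Finset.disjoint_union_left]
    refine ⟨hdis, Finset.disjoint_left.2 fun x hx hxB => ?_⟩
    rw [Finset.mem_sdiff] at hx
    have hxcl := (hYZ x hx.1).resolve_left hx.2
    -- No contract of `B` has been rejected before, so the student who offers `y` weakly prefers it
    -- to her contract in `B`. Stability of `B` then puts `y` in `B` or in the span of still heavier
    -- members. Thus `x` is spanned by other members of the independent set `B`.
    have hsub : heavier w Z x ⊆ N.closure (heavier w B x) := fun y hy => by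
      have hyY := hZY hy.1
      have hy' := mem_studentsChoice.1 hyY
      rcases hB.not_block y (hYX hyY) hy'.2.1 (fun b hb hby => or_iff_not_imp_left.2 fun hne =>
        hy'.2.2 b (Finset.mem_sdiff.2 ⟨hB.subset hb, fun h => Finset.disjoint_left.1 hdis h hb⟩)
          hby hne) with h | h
      · exact N.mem_closure_of_mem' ⟨h, hy.2⟩ (hN.ground ▸ Set.mem_univ y)
      · exact N.closure_subset_closure (heavier_trans hy.2.le) h
    refine hB.indep.notMem_closure_sdiff_of_mem (Finset.mem_coe.2 hxB) ?_
    refine N.closure_subset_closure ?_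
      (Matroid.closure_subset_closure_of_subset_closure hsub hxcl)
    rintro b ⟨hb, hlt⟩
    exact ⟨hb, fun h => by rw [h] at hlt; exact lt_irrefl _ hlt⟩

theorem IsRejectedSet.empty : IsRejectedSet N w X P ∅ :=
  ⟨fun _ h => absurd h (Finset.notMem_empty _), fun B _ => Finset.disjoint_empty_left B⟩

/-- The final rejected set `R` is exposed because its two invariants yield stability and
student-optimality of the output. -/
theorem exists_gdaLoop_eq (hN : IsConstraintMatroid N g)
    (hpos : ∀ x ∈ X, 0 < w x) (hinj : Set.InjOn w (X : Set (S × C))) (Re : Finset (S × C))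
    (hRe : IsRejectedSet N w X P Re) :
    ∃ R, IsRejectedSet N w X P R ∧ gdaLoop X P g w Re = studentsChoice P (X \ R) ∧
      studentsChoice P (X \ R) ⊆ collegesChoice g w (studentsChoice P (X \ R)) := by
  induction Re using gdaLoop.induct X P g w with
  | case1 Re h =>
    refine ⟨Re, hRe, ?_, Finset.sdiff_eq_empty_iff_subset.1 h⟩
    rw [gdaLoop, if_pos h]
  | case2 Re h ih =>
    rw [gdaLoop, if_neg h]
    exact ih (hRe.union_rejected hN hpos hinj)

/-- A contract in `R` is spanned by heavier final ones. One outside `R` was available to its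
student, so if she weakly prefers it to her final contract, it is that contract. -/
theorem isStableMatching_gda (hN : IsConstraintMatroid N g) (hP : IsPrefProfile X P)
    (hpos : ∀ x ∈ X, 0 < w x) (hinj : Set.InjOn w (X : Set (S × C))) :
    IsStableMatching N w X P (gda X P g w) := by
  obtain ⟨R, hR, hA, hch⟩ := exists_gdaLoop_eq hN hpos hinj ∅ IsRejectedSet.empty
  rw [gda, hA]
  refine ⟨(studentsChoice_subset _ _).trans Finset.sdiff_subset, ?_,
    fun b hb => (mem_studentsChoice.1 hb).2.1, hP.injOn_studentsChoice Finset.sdiff_subset,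
    fun x hx hacc hbest => ?_⟩
  · rw [hN.indep_iff, hch.antisymm (collegesChoice_subset _ _ _)]
    exact hN.collegesChoice_feasible _ _
  · by_cases hxR : x ∈ R
    · exact Or.inr (hR.mem_closure x hxR)
    obtain ⟨a, ha, hax, h | h⟩ := hP.exists_mem_studentsChoice Finset.sdiff_subset
      (Finset.mem_sdiff.2 ⟨hx, hxR⟩) hacc
    · exact Or.inl (h ▸ ha)
    · rcases hbest a ha hax with h' | h'
      · exact Or.inl (h' ▸ ha)
      · have haX : (x.1, a.2) ∈ X :=
          hax ▸ (Finset.mem_sdiff.1 (studentsChoice_subset _ _ ha)).1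
        exact absurd (hP.trans hx haX (some_mem_studentOutcomes.2 hx) h' h) (hP.irrefl hx)

theorem weaklyDominates_gda (hN : IsConstraintMatroid N g) (hP : IsPrefProfile X P)
    (hpos : ∀ x ∈ X, 0 < w x) (hinj : Set.InjOn w (X : Set (S × C))) {B : Finset (S × C)}
    (hB : IsStableMatching N w X P B) : WeaklyDominates P (gda X P g w) B := by
  obtain ⟨R, hR, hA, -⟩ := exists_gdaLoop_eq hN hpos hinj ∅ IsRejectedSet.empty
  rw [gda, hA]
  intro b hb
  exact hP.exists_mem_studentsChoice Finset.sdiff_subset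
    (Finset.mem_sdiff.2 ⟨hB.subset hb, fun h => Finset.disjoint_left.1 (hR.disjoint B hB) h hb⟩)
    (hB.acceptable b hb)

/-- Strategyproofness of deferred acceptance: no contract obtained by a misreport of `s` is better
than the outcome of reporting truthfully. -/
theorem gda_update_not_better (hN : IsConstraintMatroid N g) (hP : IsPrefProfile X P)
    (hpos : ∀ x ∈ X, 0 < w x) (hinj : Set.InjOn w (X : Set (S × C))) {s : S}
    {r : Option C → Option C → Prop} (hP' : IsPrefProfile X (Function.update P s r)) {c : C}
    (hc : (s, c) ∈ gda X (Function.update P s r) g w) (hacc : P s (some c) none)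
    (hbetter : ∀ a, (s, a) ∈ gda X P g w → P s (some c) (some a)) : False := by
  have hA := isStableMatching_gda hN hP hpos hinj
  have hB := isStableMatching_gda hN hP' hpos hinj
  set A := gda X P g w with hAdef
  set B := gda X (Function.update P s r) g w
  have hcX : (s, c) ∈ X := hB.subset hc
  have hsubst : ∀ X' ⊆ X, IsStableMatching N w X' P (gda X' P g w) ∧
      ∀ B', IsStableMatching N w X' P B' → WeaklyDominates P (gda X' P g w) B' :=
    fun X' hX' => ⟨isStableMatching_gda hN (hP.mono hX') (fun x hx => hpos x (hX' hx))
      (hinj.mono (by exact_mod_cast hX')), fun B' hB' => weaklyDominates_gda hN (hP.mono hX')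
        (fun x hx => hpos x (hX' hx)) (hinj.mono (by exact_mod_cast hX')) hB'⟩
  classical
  -- `s` may only sign contracts that are at least as good as `(s, c)`.
  let X₁ := X.filter fun x => x.1 = s → x.2 = c ∨ P s (some x.2) (some c)
  -- `s` may only sign `(s, c)`.
  let X₂ := X.filter fun x => x.1 = s → x.2 = c
  have hX₁ : X₁ ⊆ X := Finset.filter_subset _ _
  have hX₂ : X₂ ⊆ X := Finset.filter_subset _ _
  have hX₂₁ : X₂ ⊆ X₁ := fun x hx => by
    rw [Finset.mem_filter] at hx ⊢
    exact ⟨hx.1, fun h => Or.inl (hx.2 h)⟩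
  obtain ⟨hD, -⟩ := hsubst X₁ hX₁
  set D := gda X₁ P g w
  -- If `D` matched `s`, her deleted contracts would be worse than the one she holds and could not
  -- block, so `D` would be stable in `X`. Then `A`, which dominates it, would give her something at
  -- least as good as `(s, c)`.
  have hDs : ∀ d ∈ D, d.1 ≠ s := by
    rintro ⟨s', d⟩ hd (rfl : s' = s)
    have hdX₁ := Finset.mem_filter.1 (hD.subset hd)
    have hdX : (s', d) ∈ X := hdX₁.1
    have hdc : d = c ∨ P s' (some d) (some c) := hdX₁.2 rfl
    have hDX : IsStableMatching N w X P D := by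
      refine ⟨hD.subset.trans hX₁, hD.indep, hD.acceptable, hD.injOn, ?_⟩
      rintro ⟨t, x⟩ hx hxacc hbest
      refine hD.not_block _ (Finset.mem_filter.2 ⟨hx, ?_⟩) hxacc hbest
      rintro (rfl : t = s')
      rcases hbest _ hd rfl with h | h
      · obtain rfl : d = x := (Prod.mk.inj h).2
        exact hdc
      · rcases hdc with rfl | hdc
        · exact Or.inr h
        · exact Or.inr (hP.trans hx hdX (some_mem_studentOutcomes.2 hcX) h hdc)
    obtain ⟨⟨t, a⟩, ha, hat, had⟩ := weaklyDominates_gda hN hP hpos hinj hDX _ hd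
    obtain rfl : t = s' := hat
    have haX := hA.subset ha
    have hca := hbetter a ha
    have hac : a = c ∨ P t (some a) (some c) := by
      rcases had with h | h
      · obtain rfl : a = d := (Prod.mk.inj h).2
        exact hdc
      · rcases hdc with rfl | hdc
        · exact Or.inr h
        · exact Or.inr (hP.trans haX hdX (some_mem_studentOutcomes.2 hcX) h hdc)
    rcases hac with rfl | hac
    · exact hP.irrefl hcX hca
    · exact hP.irrefl hcX (hP.trans hcX haX (some_mem_studentOutcomes.2 hcX) hca hac)
  have hD₂ : IsStableMatching N w X₂ P D :=
    ⟨fun d hd => Finset.mem_filter.2 ⟨hX₁ (hD.subset hd), fun h => absurd h (hDs d hd)⟩,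
      hD.indep, hD.acceptable, hD.injOn, fun x hx => hD.not_block x (hX₂₁ hx)⟩
  have hBs : ∀ b ∈ B, b.1 = s → b = (s, c) := fun b hb hbs => hB.injOn hb hc hbs
  -- Truth and misreport differ only for `s`, and her single contract in `X₂` already belongs to
  -- `B`.
  have hB₂ : IsStableMatching N w X₂ P B := by
    refine ⟨fun b hb => Finset.mem_filter.2 ⟨hB.subset hb, fun h => by rw [hBs b hb h]⟩,
      hB.indep, fun b hb => ?_, hB.injOn, fun x hx hxacc hbest => ?_⟩
    · by_cases hbs : b.1 = s
      · rw [hBs b hb hbs]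
        exact hacc
      · have := hB.acceptable b hb
        rwa [Function.update_of_ne hbs] at this
    · by_cases hxs : x.1 = s
      · have hxc : x = (s, c) := Prod.ext hxs ((Finset.mem_filter.1 hx).2 hxs)
        exact Or.inl (hxc ▸ hc)
      · refine hB.not_block x (hX₂ hx) ?_ ?_
        · rwa [Function.update_of_ne hxs]
        · rwa [Function.update_of_ne hxs]
  obtain ⟨hE, hEdom⟩ := hsubst X₂ hX₂
  -- Both match the same students as the student-optimal matching of `X₂`.
  have hfst : B.image Prod.fst = D.image Prod.fst :=
    (hE.image_fst_eq hN.ground hB₂ (hEdom B hB₂)).trans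
      (hE.image_fst_eq hN.ground hD₂ (hEdom D hD₂)).symm
  have hs : s ∈ D.image Prod.fst := hfst ▸ Finset.mem_image.2 ⟨(s, c), hc, rfl⟩
  obtain ⟨d, hd, hds⟩ := Finset.mem_image.1 hs
  exact hDs d hd hds

end GDA

/-! ### Independence of the reports of absent students -/

section ReportIndependence

variable {S C : Type*} [Fintype S] [DecidableEq S] [DecidableEq C]

theorem studentsChoice_update {P : PrefProfile S C} {s : S} {r : Option C → Option C → Prop}
    {Y : Finset (S × C)} (hs : ∀ y ∈ Y, y.1 ≠ s) :
    studentsChoice (Function.update P s r) Y = studentsChoice P Y := by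
  ext x
  rw [mem_studentsChoice, mem_studentsChoice]
  refine and_congr_right fun hx => ?_
  rw [Function.update_of_ne (hs x hx)]

theorem gdaLoop_update {X : Finset (S × C)} {P : PrefProfile S C} {s : S}
    {r : Option C → Option C → Prop} (hs : ∀ x ∈ X, x.1 ≠ s) (g : (C → ℕ) → EReal)
    (w : S × C → ℝ) (Re : Finset (S × C)) :
    gdaLoop X (Function.update P s r) g w Re = gdaLoop X P g w Re := by
  have hch : ∀ R, studentsChoice (Function.update P s r) (X \ R) = studentsChoice P (X \ R) :=
    fun R => studentsChoice_update fun y hy => hs y (Finset.mem_sdiff.1 hy).1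
  induction Re using gdaLoop.induct X P g w with
  | case1 Re h =>
    rw [gdaLoop, gdaLoop.eq_def X P, hch, if_pos h, if_pos h]
  | case2 Re h ih =>
    rw [gdaLoop, gdaLoop.eq_def X P, hch, if_neg h, if_neg h, ih]

end ReportIndependence

/-! ### The constraint of a stage -/

section StageConstraint

variable {S C : Type*} [DecidableEq C]

/-- Feasibility of `Y` is what places the zero vector in the induced set. -/
theorem isHereditary_stageConstraint [Fintype C] {f : (C → ℕ) → EReal} (hf : IsHereditary f)
    {Y : Finset (S × C)} (hY : f (countVec Y) = 0) (d : ℕ) :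
    IsHereditary (truncate (residualConstraint f Y) d) := by
  constructor
  · simpa [inducedVectors, truncate, residualConstraint] using hY
  · intro ν ν' hlt hν
    simp only [inducedVectors, truncate, residualConstraint, Set.mem_ofPred_eq] at hν ⊢
    split_ifs at hν with hd
    · rw [if_pos ((Finset.sum_le_sum fun c _ => hlt.le c).trans hd)]
      exact hf.of_le (add_le_add_left hlt.le _) hν
    · simp at hν

theorem stageConstraint_values [Fintype C] {f : (C → ℕ) → EReal}
    (hf : ∀ ν, f ν = ⊥ ∨ f ν = 0) (Y : Finset (S × C)) (d : ℕ) (ν : C → ℕ) :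
    truncate (residualConstraint f Y) d ν = ⊥ ∨ truncate (residualConstraint f Y) d ν = 0 := by
  unfold truncate
  split_ifs
  · exact hf _
  · exact Or.inl rfl

end StageConstraint

/-- Allows final matchings to be replaced by the outputs of the stage that processes `s`. -/
theorem studentWeaklyPrefers_congr {S C : Type*} [DecidableEq S]
    {r : Option C → Option C → Prop} {s : S} {A A' B B' : Finset (S × C)}
    (hA : contractsOf A s = contractsOf A' s) (hB : contractsOf B s = contractsOf B' s) :
    StudentWeaklyPrefers r s A B ↔ StudentWeaklyPrefers r s A' B' := by
  rw [StudentWeaklyPrefers, StudentWeaklyPrefers, StudentPrefers, StudentPrefers, hA, hB]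

theorem contractsOf_eq_empty {S C : Type*} [DecidableEq S] {Y : Finset (S × C)} {s : S}
    (h : ∀ y ∈ Y, y.1 ≠ s) : contractsOf Y s = ∅ :=
  Finset.filter_eq_empty_iff.2 fun y hy => h y hy

theorem contractsOf_eq_singleton {S C : Type*} [DecidableEq S] {Y : Finset (S × C)}
    (hY : Set.InjOn Prod.fst (Y : Set (S × C))) {s : S} {c : C} (hc : (s, c) ∈ Y) :
    contractsOf Y s = {(s, c)} := by
  ext y
  rw [contractsOf, Finset.mem_filter, Finset.mem_singleton]
  constructor
  · exact fun h => hY h.1 hc h.2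
  · rintro rfl
    exact ⟨hc, rfl⟩

theorem IsPrefProfile.update {S C : Type*} [DecidableEq S] {X : Finset (S × C)}
    {P : PrefProfile S C} (hP : IsPrefProfile X P) {s : S} {r : Option C → Option C → Prop}
    (hr : IsStrictPref (studentOutcomes X s) r) : IsPrefProfile X (Function.update P s r) := by
  intro t
  by_cases h : t = s
  · subst h
    simpa using hr
  · simpa [Function.update_of_ne h] using hP t

/-! ### Strategyproofness of a single stage -/

section StrategyproofGDA

variable {S C : Type*} [Fintype S] [DecidableEq S] [DecidableEq C]

/-- Generalized deferred acceptance is strategyproof when the feasible sets form a matroid. -/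
theorem isStrategyproof_gda {N : Matroid (S × C)} {g : (C → ℕ) → EReal} {w : S × C → ℝ}
    {X : Finset (S × C)} (hN : IsConstraintMatroid N g) (hpos : ∀ x ∈ X, 0 < w x)
    (hinj : Set.InjOn w (X : Set (S × C))) : IsStrategyproof X fun P => gda X P g w := by
  intro P hP s r hr
  have hP' := hP.update hr
  have hA := isStableMatching_gda hN hP hpos hinj
  have hB := isStableMatching_gda hN hP' hpos hinj
  have key := fun c => gda_update_not_better hN hP hpos hinj hP' (c := c)
  dsimp only
  set A := gda X P g w
  set B := gda X (Function.update P s r) g w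
  have hempty : ∀ {Y : Finset (S × C)}, (¬ ∃ c, (s, c) ∈ Y) → contractsOf Y s = ∅ := fun h =>
    contractsOf_eq_empty fun y hy hys => h ⟨y.2, hys ▸ hy⟩
  by_cases ha : ∃ a, (s, a) ∈ A
  · obtain ⟨a, ha⟩ := ha
    have hAs := contractsOf_eq_singleton hA.injOn ha
    have huniq : ∀ a', (s, a') ∈ A → a' = a := fun a' ha' =>
      (Prod.mk.inj (hA.injOn ha' ha rfl)).2
    by_cases hb : ∃ b, (s, b) ∈ B
    · obtain ⟨b, hb⟩ := hb
      have hBs := contractsOf_eq_singleton hB.injOn hb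
      by_cases hab : a = b
      · exact Or.inr (by rw [hAs, hBs, hab])
      · refine Or.inl (Or.inl ⟨a, b, hAs, hBs, ?_⟩)
        have haX := hA.subset ha
        have hbX := hB.subset hb
        refine ((hP s).2.2 _ (some_mem_studentOutcomes.2 haX) _ (some_mem_studentOutcomes.2 hbX)
          fun h => hab (Option.some_inj.1 h)).resolve_right fun hba => ?_
        refine key b hb ?_ fun a' ha' => by rwa [huniq a' ha']
        exact hP.trans hbX haX (none_mem_studentOutcomes X s) hba (hA.acceptable _ ha)
    · exact Or.inl (Or.inr (Or.inl ⟨a, hAs, hempty hb, hA.acceptable _ ha⟩))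
  · have hAs := hempty ha
    by_cases hb : ∃ b, (s, b) ∈ B
    · obtain ⟨b, hb⟩ := hb
      refine Or.inl (Or.inr (Or.inr ⟨b, hAs, contractsOf_eq_singleton hB.injOn hb, ?_⟩))
      refine ((hP s).2.2 _ (none_mem_studentOutcomes X s) _
        (some_mem_studentOutcomes.2 (hB.subset hb)) nofun).resolve_right fun hacc => ?_
      exact key b hb hacc fun a ha' => absurd ⟨a, ha'⟩ ha
    · exact Or.inr (by rw [hAs, hempty hb])

end StrategyproofGDA

theorem List.Nodup.notMem_take_of_mem_drop {α : Type*} {l : List α} (hl : l.Nodup) {d : ℕ} {a : α}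
    (ha : a ∈ l.drop d) : a ∉ l.take d :=
  fun h => List.disjoint_take_drop hl le_rfl h ha

/-! ### The run of the multi-stage mechanism -/

namespace MatchingMarket

section StageContracts

variable {S C : Type*} [DecidableEq S] {M : MatchingMarket S C}

/-- The contracts that are available when the top `d` students of `l` are processed. -/
def stageContracts (M : MatchingMarket S C) (l : List S) (d : ℕ) : Finset (S × C) :=
  M.X.filter fun x => x.1 ∈ l.take d

theorem stageContracts_subset (l : List S) (d : ℕ) : M.stageContracts l d ⊆ M.X :=
  Finset.filter_subset _ _

theorem fst_mem_take_of_mem_stageContracts {l : List S} {d : ℕ} {x : S × C}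
    (hx : x ∈ M.stageContracts l d) : x.1 ∈ l.take d :=
  (Finset.mem_filter.1 hx).2

theorem fst_mem_take_of_mem_gda [Fintype S] [DecidableEq C] {P : PrefProfile S C} (l : List S)
    (d : ℕ) (g : (C → ℕ) → EReal) :
    ∀ x ∈ gda (M.stageContracts l d) P g M.w, x.1 ∈ l.take d := by
  suffices h : ∀ X Re, gdaLoop X P g M.w Re ⊆ X from
    fun x hx => fst_mem_take_of_mem_stageContracts (h _ _ hx)
  intro X Re
  induction Re using gdaLoop.induct X P g M.w with
  | case1 Re h =>
    rw [gdaLoop, if_pos h]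
    exact (studentsChoice_subset _ _).trans Finset.sdiff_subset
  | case2 Re h ih =>
    rwa [gdaLoop, if_neg h]

end StageContracts

variable {S C : Type*} [Fintype S] [DecidableEq S] [Fintype C] [DecidableEq C]
  {M : MatchingMarket S C} {L : List S} {δ : StageSizeRule S C} {P : PrefProfile S C}

/-- The stage size that the rule `δ` chooses in stage `k`. -/
noncomputable def stageSize (M : MatchingMarket S C) (L : List S) (δ : StageSizeRule S C)
    (P : PrefProfile S C) (k : ℕ) : ℕ :=
  δ k (M.stageState L δ P k) (pastReports P (M.stageState L δ P k).rest)

theorem stageState_succ_of_eq_nil {k : ℕ} (h : (M.stageState L δ P k).rest = []) :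
    M.stageState L δ P (k + 1) = M.stageState L δ P k := by
  rw [stageState, if_pos h]

theorem stageState_succ_of_ne_nil {k : ℕ} (h : (M.stageState L δ P k).rest ≠ []) :
    M.stageState L δ P (k + 1) =
      ⟨(M.stageState L δ P k).rest.drop (M.stageSize L δ P k), (M.stageState L δ P k).Y ∪
        gda (M.stageContracts (M.stageState L δ P k).rest (M.stageSize L δ P k)) P
          (truncate (residualConstraint M.f (M.stageState L δ P k).Y) (M.stageSize L δ P k))
          M.w⟩ := by
  rw [stageState, if_neg h]
  rfl

theorem rest_stageState_succ_subset (k : ℕ) :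
    (M.stageState L δ P (k + 1)).rest ⊆ (M.stageState L δ P k).rest := by
  by_cases h : (M.stageState L δ P k).rest = []
  · rw [stageState_succ_of_eq_nil h]
    exact List.Subset.refl _
  · rw [stageState_succ_of_ne_nil h]
    exact List.drop_subset _ _

theorem nodup_rest_stageState (hL : L.Nodup) (k : ℕ) : (M.stageState L δ P k).rest.Nodup := by
  induction k with
  | zero => exact hL
  | succ k ih =>
    by_cases h : (M.stageState L δ P k).rest = []
    · rwa [stageState_succ_of_eq_nil h]
    · rw [stageState_succ_of_ne_nil h]
      exact ih.sublist (List.drop_sublist _ _)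

/-- Since the master-list has no repetitions, a processed student never comes up again. -/
theorem fst_notMem_rest_of_mem_Y (hL : L.Nodup) (k : ℕ) :
    ∀ x ∈ (M.stageState L δ P k).Y, x.1 ∉ (M.stageState L δ P k).rest := by
  induction k with
  | zero => exact fun x hx => absurd hx (Finset.notMem_empty x)
  | succ k ih =>
    intro x hx hrest
    by_cases h : (M.stageState L δ P k).rest = []
    · rw [stageState_succ_of_eq_nil h] at hx hrest
      exact ih x hx hrest
    · have hrest' := rest_stageState_succ_subset k hrest
      rw [stageState_succ_of_ne_nil h] at hx hrest
      rcases Finset.mem_union.1 hx with hx | hx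
      · exact ih x hx hrest'
      · exact (nodup_rest_stageState hL k).notMem_take_of_mem_drop hrest
          (fst_mem_take_of_mem_gda _ _ _ x hx)

theorem exists_stage_isConstraintMatroid (hf : IsHereditary M.f) (hδ : M.IsAdmissible L δ)
    (hP : IsPrefProfile M.X P) {k : ℕ} (hk : (M.stageState L δ P k).rest ≠ [])
    (hY : M.f (countVec (M.stageState L δ P k).Y) = 0) :
    ∃ N : Matroid (S × C), IsConstraintMatroid N
      (truncate (residualConstraint M.f (M.stageState L δ P k).Y) (M.stageSize L δ P k)) :=
  exists_isConstraintMatroid (isHereditary_stageConstraint hf hY _) (hδ P hP k hk)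
    (stageConstraint_values M.f_values _ _)

/-- Feasibility under the residual constraint is feasibility of the union, as counts of disjoint
sets add. The induction hypothesis is needed to have a matroid at the stage. -/
theorem f_countVec_stageState (hf : IsHereditary M.f) (hL : L.Nodup) (hδ : M.IsAdmissible L δ)
    (hP : IsPrefProfile M.X P) (k : ℕ) : M.f (countVec (M.stageState L δ P k).Y) = 0 := by
  induction k with
  | zero =>
    simp only [stageState, countVec_empty]
    exact hf.1
  | succ k ih =>
    by_cases h : (M.stageState L δ P k).rest = []
    · rwa [stageState_succ_of_eq_nil h]
    obtain ⟨N, hN⟩ := exists_stage_isConstraintMatroid hf hδ hP h ih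
    have hsub := stageContracts_subset (M := M) (M.stageState L δ P k).rest (M.stageSize L δ P k)
    have hA := isStableMatching_gda hN (hP.mono hsub) (fun x hx => M.w_pos x (hsub hx))
      (M.w_injOn.mono (by exact_mod_cast hsub))
    have hfeas := (hN.indep_iff _).1 hA.indep
    rw [stageState_succ_of_ne_nil h]
    dsimp only
    rw [countVec_union, add_comm]
    · unfold truncate at hfeas
      split_ifs at hfeas with hd
      · exact hfeas
      · simp at hfeas
    · exact Finset.disjoint_left.2 fun x hx hx' => fst_notMem_rest_of_mem_Y hL k x hx
        (List.mem_of_mem_take (fst_mem_take_of_mem_gda _ _ _ x hx'))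

theorem contractsOf_stageState_succ {k : ℕ} {s : S}
    (hs : s ∉ (M.stageState L δ P k).rest) :
    contractsOf (M.stageState L δ P (k + 1)).Y s = contractsOf (M.stageState L δ P k).Y s := by
  by_cases h : (M.stageState L δ P k).rest = []
  · rw [stageState_succ_of_eq_nil h]
  · rw [stageState_succ_of_ne_nil h]
    dsimp only
    rw [contractsOf, Finset.filter_union]
    refine (congrArg _ (contractsOf_eq_empty fun y hy hys => hs ?_)).trans (Finset.union_empty _)
    exact hys ▸ List.mem_of_mem_take (fst_mem_take_of_mem_gda _ _ _ y hy)

theorem contractsOf_stageState_of_le {k n : ℕ} (hkn : k ≤ n) {s : S}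
    (hs : s ∉ (M.stageState L δ P k).rest) :
    contractsOf (M.stageState L δ P n).Y s = contractsOf (M.stageState L δ P k).Y s ∧
      s ∉ (M.stageState L δ P n).rest := by
  induction n, hkn using Nat.le_induction with
  | base => exact ⟨rfl, hs⟩
  | succ n _ ih =>
    exact ⟨(contractsOf_stageState_succ ih.2).trans ih.1,
      fun h => ih.2 (rest_stageState_succ_subset n h)⟩

/-- The rule sees only reports of students already processed, and `s` still remains. -/
theorem stageSize_update {s : S} {r : Option C → Option C → Prop} {k : ℕ}
    (heq : M.stageState L δ (Function.update P s r) k = M.stageState L δ P k)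
    (hs : s ∈ (M.stageState L δ P k).rest) :
    M.stageSize L δ (Function.update P s r) k = M.stageSize L δ P k := by
  have hpast : pastReports (Function.update P s r) (M.stageState L δ P k).rest =
      pastReports P (M.stageState L δ P k).rest := by
    ext1 t
    unfold pastReports
    split_ifs with ht
    · rfl
    · rw [Function.update_of_ne]
      rintro rfl
      exact ht hs
  rw [stageSize, heq, hpast, stageSize]

/-- The report of a student has no influence before she is processed. -/
theorem stageState_update (hL : L.Nodup) {s : S} (r : Option C → Option C → Prop) (k : ℕ)
    (hs : s ∈ (M.stageState L δ P k).rest) :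
    M.stageState L δ (Function.update P s r) k = M.stageState L δ P k := by
  induction k with
  | zero => rfl
  | succ k ih =>
    have hsk := rest_stageState_succ_subset k hs
    have heq := ih hsk
    have hne : (M.stageState L δ P k).rest ≠ [] := List.ne_nil_of_mem hsk
    have hsize := stageSize_update heq hsk
    rw [stageState_succ_of_ne_nil hne] at hs
    rw [stageState_succ_of_ne_nil (heq ▸ hne), stageState_succ_of_ne_nil hne, heq, hsize, gda,
      gdaLoop_update, ← gda]
    intro x hx hxs
    exact (nodup_rest_stageState hL k).notMem_take_of_mem_drop hs
      (hxs ▸ fst_mem_take_of_mem_stageContracts hx)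

/-- Earlier stages hold no contract of a student who remains, and later ones add none for a student
who has left. -/
theorem contractsOf_msgda (hL : L.Nodup) {s : S} {k : ℕ} (hkL : k < L.length)
    (hs : s ∈ (M.stageState L δ P k).rest) (hs' : s ∉ (M.stageState L δ P (k + 1)).rest) :
    contractsOf (M.msgda L δ P) s =
      contractsOf (gda (M.stageContracts (M.stageState L δ P k).rest (M.stageSize L δ P k)) P
        (truncate (residualConstraint M.f (M.stageState L δ P k).Y) (M.stageSize L δ P k))
        M.w) s := by
  rw [msgda, (contractsOf_stageState_of_le hkL hs').1,
    stageState_succ_of_ne_nil (List.ne_nil_of_mem hs)]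
  dsimp only
  rw [contractsOf, Finset.filter_union]
  refine (congrArg (· ∪ _) (contractsOf_eq_empty fun y hy hys => ?_)).trans
    (Finset.empty_union _)
  exact fst_notMem_rest_of_mem_Y hL k y hy (hys ▸ hs)

/-- Every student of the master-list is processed in some stage. -/
theorem exists_stage_processed {s : S} (hs : s ∈ L) :
    ∃ k < L.length, s ∈ (M.stageState L δ P k).rest ∧
      s ∉ (M.stageState L δ P (k + 1)).rest := by
  by_contra! h
  have hall : ∀ k ≤ L.length, s ∈ (M.stageState L δ P k).rest := by
    intro k
    induction k with
    | zero => exact fun _ => hs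
    | succ k ih => exact fun hk => h k hk (ih (Nat.le_of_succ_le hk))
  have := hall _ le_rfl
  rw [rest_stageState_length] at this
  exact List.not_mem_nil this

end MatchingMarket

/-! ### Reduction to the stage that processes the student -/

theorem mainTheorem1 {S C : Type*} [Fintype S] [DecidableEq S] [Fintype C] [DecidableEq C]
    (M : MatchingMarket S C) (hf : IsHereditary M.f)
    (L : List S) (hL_nodup : L.Nodup) (hL_mem : ∀ s : S, s ∈ L)
    (δ : StageSizeRule S C) (hδ : M.IsAdmissible L δ) :
    IsStrategyproof M.X (M.msgda L δ) := by
  intro P hP s r hr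
  obtain ⟨k, hkL, hs, hs'⟩ := MatchingMarket.exists_stage_processed (M := M) (δ := δ)
    (P := P) (hL_mem s)
  have heq := MatchingMarket.stageState_update hL_nodup r k hs
  have hsize := MatchingMarket.stageSize_update heq hs
  have hne := List.ne_nil_of_mem hs
  have hsP : s ∈ (M.stageState L δ (Function.update P s r) k).rest := heq ▸ hs
  have hsP' : s ∉ (M.stageState L δ (Function.update P s r) (k + 1)).rest := by
    -- The matchings after stage `k` may differ, but the remaining lists agree: both drop the same
    -- number of students from the same list.
    rw [MatchingMarket.stageState_succ_of_ne_nil hne] at hs'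
    rw [MatchingMarket.stageState_succ_of_ne_nil (List.ne_nil_of_mem hsP), heq, hsize]
    exact hs'
  have hout := MatchingMarket.contractsOf_msgda hL_nodup hkL hsP hsP'
  rw [heq, hsize] at hout
  rw [studentWeaklyPrefers_congr (MatchingMarket.contractsOf_msgda hL_nodup hkL hs hs') hout]
  obtain ⟨N, hN⟩ := MatchingMarket.exists_stage_isConstraintMatroid hf hδ hP hne
    (MatchingMarket.f_countVec_stageState hf hL_nodup hδ hP k)
  have hsub := MatchingMarket.stageContracts_subset (M := M) (M.stageState L δ P k).rest
    (M.stageSize L δ P k)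
  exact isStrategyproof_gda hN (fun x hx => M.w_pos x (hsub hx))
    (M.w_injOn.mono (by exact_mod_cast hsub)) P (hP.mono hsub) s r
    (hr.mono (studentOutcomes_mono hsub s))
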